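/- Let $Y$ be a metrizable space with at least two points. Let $X$ be a $Y$-Tychonoff space, i.e. a topological space such that for every closed $A\subseteq X$, every $y_0\in Y$, every finite $F\subseteq X\setminus A$ and every function $f:F\to Y$ there is a continuous $\bar f:X\to Y$ with $\bar f|_F=f$ and $\bar f(A)\subseteq\{y_0\}$. Let $B_0(X,Y)$ be the set of continuous functions $X\to Y$; for $0<\alpha<\omega_1$ let $B_\alpha(X,Y)$ be the set of pointwise limits of sequences from $\bigcup_{\beta<\alpha}B_\beta(X,Y)$; and put $B(X,Y)=\bigcup_{\alpha<\omega_1}B_\alpha(X,Y)$. Let $B_1^{st}(X,Y)$ be the set of all $f:X\to Y$ for which there are continuous $f_n:X\to Y$ ($n\in\omega$) such that $\{n: f_n(x)\neq f(x)\}$ is finite for every $x\in X$. Let $X_{\aleph_0}$ be the set $X$ with the Baire topology, whose base is the family of all zero-sets $f^{-1}(0)$ of continuous $f:X\to\mathbb R$. Let $B_1^{st}(X,Y)\subseteq H\subseteq B(X,Y)$, where $H$ carries the topology of pointwise convergence inherited from the product $Y^X$. Then the following are equivalent: (i) $H$ is a Fréchet–Urysohn space; (ii) $H$ is a sequential space;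 (iii) $H$ has countable tightness; (iv) $X_{\aleph_0}$ is a Lindelöf space; (v) $X_{\aleph_0}$ has the property $\gamma$: if $\mathcal U$ is a family of open sets such that every finite set is contained in a member of $\mathcal U$, then there is a sequence $(U_n)_{n\in\omega}$ of members of $\mathcal U$ such that every point belongs to $U_n$ for all but finitely many $n$. Moreover, if $X$ is scattered (every nonempty subspace has an isolated point), then (i)–(v) are equivalent to (vi) $X$ is a Lindelöf space. -/

import Mathlib

open Set Filter Topology

/-- `X` is `Y`-Tychonoff: for every closed `A ⊆ X`, every point `y₀` of `Y` and every function
`f : F → Y` on a finite set `F ⊆ X \ A` there is a continuous `g : X → Y` that extends `f` and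
maps `A` into `{y₀}`. -/
def IsYTychonoff (X Y : Type*) [TopologicalSpace X] [TopologicalSpace Y] : Prop :=
  ∀ (A : Set X), IsClosed A → ∀ (y₀ : Y) (F : Set X), F.Finite → F ⊆ Aᶜ → ∀ f : F → Y,
    ∃ g : X → Y, Continuous g ∧ (∀ x : F, g x = f x) ∧ g '' A ⊆ {y₀}

/-- `BaireClass α f` says that `f : X → Y` belongs to the Baire class `B_α(X, Y)`: class `0`
consists of the continuous functions, and for `α ≠ 0` class `α` consists of the pointwise limits
of sequences of functions of classes smaller than `α`. -/
inductive BaireClass {X Y : Type*} [TopologicalSpace X] [TopologicalSpace Y] :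
    Ordinal.{0} → (X → Y) → Prop
  | zero (f : X → Y) (hf : Continuous f) : BaireClass 0 f
  | limit (α : Ordinal.{0}) (hα : α ≠ 0) (f : X → Y) (u : ℕ → X → Y) (β : ℕ → Ordinal.{0})
      (hβ : ∀ n, β n < α) (hu : ∀ n, BaireClass (β n) (u n))
      (hf : ∀ x, Tendsto (fun n => u n x) atTop (𝓝 (f x))) : BaireClass α f

/-- The set `B(X, Y)` of all Baire functions: the union of the classes `B_α(X, Y)`, `α < ω₁`. -/
def baireFunctions (X Y : Type*) [TopologicalSpace X] [TopologicalSpace Y] : Set (X → Y) :=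
  {f | ∃ α : Ordinal.{0}, α < Ordinal.omega 1 ∧ BaireClass α f}

/-- The stable first Baire class `B₁ˢᵗ(X, Y)`: limits of stably convergent sequences of
continuous functions. -/
def stableBaireOne (X Y : Type*) [TopologicalSpace X] [TopologicalSpace Y] : Set (X → Y) :=
  {f | ∃ u : ℕ → X → Y, (∀ n, Continuous (u n)) ∧ ∀ x, {n | u n x ≠ f x}.Finite}

/-- `Z` is a zero-set of `X`: the set of zeros of a continuous real-valued function. -/
def IsZeroSet {X : Type*} [TopologicalSpace X] (Z : Set X) : Prop :=
  ∃ f : X → ℝ, Continuous f ∧ Z = f ⁻¹' {0}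

theorem IsZeroSet.univ {X : Type*} [TopologicalSpace X] : IsZeroSet (univ : Set X) :=
  ⟨fun _ => 0, continuous_const, by simp⟩

theorem IsZeroSet.inter {X : Type*} [TopologicalSpace X] {Z W : Set X} (hZ : IsZeroSet Z)
    (hW : IsZeroSet W) : IsZeroSet (Z ∩ W) := by
  obtain ⟨f, hf, rfl⟩ := hZ
  obtain ⟨g, hg, rfl⟩ := hW
  refine ⟨fun z => f z ^ 2 + g z ^ 2, by fun_prop, ?_⟩
  ext z
  simp only [mem_inter_iff, mem_preimage, mem_singleton_iff]
  constructor
  · rintro ⟨h1, h2⟩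
    simp [h1, h2]
  · intro h
    constructor <;> nlinarith [sq_nonneg (f z), sq_nonneg (g z)]

/-- The space `X_{ℵ₀}`: the set `X`, to be endowed with the Baire topology of `X`. -/
def BaireModification (X : Type*) : Type _ := X

/-- The Baire topology on `X`, generated by the zero-sets of `X`. -/
instance instBaireTopology (X : Type*) [TopologicalSpace X] :
    TopologicalSpace (BaireModification X) :=
  TopologicalSpace.generateFrom {Z : Set X | IsZeroSet Z}

/-- The zero-sets of `X` form a base of the Baire topology. -/
theorem isTopologicalBasis_baireModification (X : Type*) [TopologicalSpace X] :
    TopologicalSpace.IsTopologicalBasis (α := BaireModification X)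
      {Z : Set X | IsZeroSet Z} where
  exists_subset_inter _ hZ _ hW _ hx := ⟨_, IsZeroSet.inter (X := X) hZ hW, hx, subset_rfl⟩
  sUnion_eq := eq_univ_of_univ_subset (subset_sUnion_of_mem (IsZeroSet.univ (X := X)))
  eq_generateFrom := rfl

/-- `γ` is an open `ω`-cover of `X`: a family of open sets such that every finite subset of `X`
is contained in a member of `γ`. -/
def IsOpenOmegaCover {X : Type*} [TopologicalSpace X] (γ : Set (Set X)) : Prop :=
  (∀ U ∈ γ, IsOpen U) ∧ ∀ A : Set X, A.Finite → ∃ U ∈ γ, A ⊆ U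

/-- The property `γ`: every open `ω`-cover contains a sequence `(U n)` such that each point
belongs to `U n` for all but finitely many `n`. -/
def HasPropertyGamma (X : Type*) [TopologicalSpace X] : Prop :=
  ∀ γ : Set (Set X), IsOpenOmegaCover γ →
    ∃ U : ℕ → Set X, (∀ n, U n ∈ γ) ∧ ⋃ n, ⋂ i ≥ n, U i = univ

/-- Countable tightness: a point of the closure of a set is in the closure of a countable
subset of it. -/
def HasCountableTightness (Z : Type*) [TopologicalSpace Z] : Prop :=
  ∀ (A : Set Z) (z : Z), z ∈ closure A → ∃ B ⊆ A, B.Countable ∧ z ∈ closure B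

/-- A space is scattered if every nonempty subspace has an isolated point. -/
def IsScatteredSpace (X : Type*) [TopologicalSpace X] : Prop :=
  ∀ S : Set X, S.Nonempty → ∃ x ∈ S, ∃ U : Set X, IsOpen U ∧ U ∩ S = {x}

/-! ### Lindelöf spaces and P-spaces -/

/-! Zero-sets are closed under countable intersections and are clopen in the Baire topology, so
`BaireModification X` is a P-space, and every Baire function is locally constant on it. If it is
Lindelöf, so are its finite powers, and every open ω-cover has a countable ω-subcover. Countably
many clopen sets then produce only countably many membership patterns; diagonalizing over
representatives of the patterns (`exists_selection_of_omegaCovers`) yields both property γ and,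
applied to the sets where members of `A` are close to `f`, the Fréchet–Urysohn property. Conversely,
`exists_stableBaireOne` turns a cover by zero-sets into a net of stable functions converging to a
constant, and countable tightness extracts a countable subcover. In the scattered case, an isolated
point of the set where countable subcovers fail locally leads to a contradiction. -/

theorem lindelofSpace_of_nhds_subcover {Z : Type*} [TopologicalSpace Z]
    (h : ∀ U : Z → Set Z, (∀ z, U z ∈ 𝓝 z) → ∃ t : Set Z, t.Countable ∧ ⋃ z ∈ t, U z = univ) :
    LindelofSpace Z := by
  refine ⟨isLindelof_of_countable_subcover fun {ι} U hU hcov => ?_⟩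
  choose i hi using fun z => mem_iUnion.1 (hcov (mem_univ z))
  obtain ⟨t, ht, htU⟩ := h (fun z => U (i z)) fun z => (hU _).mem_nhds (hi z)
  exact ⟨i '' t, ht.image i, by rw [biUnion_image, htU]⟩

theorem exists_countable_forall_eq_of_locallyConstant {Z T : Type*} [TopologicalSpace Z]
    [LindelofSpace Z] (f : Z → T) (hf : ∀ x, ∀ᶠ z in 𝓝 x, f z = f x) :
    ∃ t : Set Z, t.Countable ∧ ∀ z, ∃ x ∈ t, f z = f x := by
  obtain ⟨t, ht, htU⟩ := LindelofSpace.elim_nhds_subcover (fun x => {z | f z = f x}) hf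
  refine ⟨t, ht, fun z => ?_⟩
  have hz : z ∈ ⋃ x ∈ t, {z | f z = f x} := htU ▸ mem_univ z
  simpa using hz

/-- The product of a Lindelöf space and a Lindelöf P-space is Lindelöf. -/
theorem lindelofSpace_prod_of_countableInter {K L : Type*} [TopologicalSpace K]
    [TopologicalSpace L] [LindelofSpace K] [LindelofSpace L]
    (hL : ∀ l : L, CountableInterFilter (𝓝 l)) : LindelofSpace (L × K) := by
  refine lindelofSpace_of_nhds_subcover fun U hU => ?_
  have hbox : ∀ (l : L) (k : K), ∃ B ∈ 𝓝 l, ∃ C ∈ 𝓝 k, B ×ˢ C ⊆ U (l, k) := fun l k =>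
    mem_nhds_prod_iff.1 (hU (l, k))
  choose B hB C hC hBC using hbox
  have htube : ∀ l, ∃ t : Set K, t.Countable ∧ ⋃ k ∈ t, C l k = univ := fun l =>
    LindelofSpace.elim_nhds_subcover (C l) (hC l)
  choose t ht htC using htube
  -- The tube lemma with a countable subcover of the fibre: the P-property of `L` replaces
  -- finiteness.
  have hW : ∀ l, (⋂ k ∈ t l, B l k) ∈ 𝓝 l := fun l => by
    have := hL l
    exact (countable_bInter_mem (ht l)).2 fun k _ => hB l k
  obtain ⟨s, hs, hsW⟩ := LindelofSpace.elim_nhds_subcover _ hW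
  refine ⟨⋃ l ∈ s, Prod.mk l '' t l, hs.biUnion fun l _ => (ht l).image _, ?_⟩
  refine eq_univ_of_forall fun ⟨l, k⟩ => ?_
  obtain ⟨l', hl', hl⟩ := mem_iUnion₂.1 (hsW.symm ▸ mem_univ l : l ∈ ⋃ l ∈ s, ⋂ k ∈ t l, B l k)
  obtain ⟨k', hk', hk⟩ := mem_iUnion₂.1 ((htC l').symm ▸ mem_univ k : k ∈ ⋃ k ∈ t l', C l' k)
  exact mem_iUnion₂.2 ⟨(l', k'), mem_iUnion₂.2 ⟨l', hl', k', hk', rfl⟩,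
    hBC l' k' ⟨mem_iInter₂.1 hl k' hk', hk⟩⟩

theorem lindelofSpace_fin_pow {Z : Type*} [TopologicalSpace Z] [LindelofSpace Z]
    (hZ : ∀ z : Z, CountableInterFilter (𝓝 z)) (n : ℕ) : LindelofSpace (Fin n → Z) := by
  induction n with
  | zero => infer_instance
  | succ n ih =>
    have := lindelofSpace_prod_of_countableInter (K := Fin n → Z) hZ
    have hsurj : Function.Surjective fun p : Z × (Fin n → Z) =>
        (Fin.cons p.1 p.2 : Fin (n + 1) → Z) :=
      fun v => ⟨(v 0, Fin.tail v), Fin.cons_self_tail v⟩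
    have hcont : Continuous fun p : Z × (Fin n → Z) => (Fin.cons p.1 p.2 : Fin (n + 1) → Z) := by
      refine continuous_pi fun i => ?_
      refine Fin.cases ?_ (fun j => ?_) i
      · simpa using continuous_fst
      · simpa only [Fin.cons_succ] using (continuous_apply j).comp' continuous_snd
    refine ⟨?_⟩
    rw [← hsurj.range_eq]
    exact isLindelof_range hcont

/-- A finite set is the range of a point of some `Fin n → Z`, so an ω-cover gives a cover of each
finite power by the cubes of its members; these powers are Lindelöf. -/
theorem exists_countable_omegaSubcover {Z ι : Type*} [TopologicalSpace Z] [LindelofSpace Z]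
    (hZ : ∀ z : Z, CountableInterFilter (𝓝 z)) (U : ι → Set Z) (hU : ∀ i, IsOpen (U i))
    (hω : ∀ A : Set Z, A.Finite → ∃ i, A ⊆ U i) :
    ∃ t : Set ι, t.Countable ∧ ∀ A : Set Z, A.Finite → ∃ i ∈ t, A ⊆ U i := by
  have hpow : ∀ n : ℕ, ∃ t : Set ι, t.Countable ∧
      (univ : Set (Fin n → Z)) ⊆ ⋃ i ∈ t, univ.pi fun _ => U i := fun n => by
    have := lindelofSpace_fin_pow hZ n
    refine isLindelof_univ.elim_countable_subcover _
      (fun i => isOpen_set_pi finite_univ fun _ _ => hU i) fun v _ => ?_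
    obtain ⟨i, hi⟩ := hω (range v) (finite_range v)
    exact mem_iUnion.2 ⟨i, fun j _ => hi (mem_range_self j)⟩
  choose t ht htU using hpow
  refine ⟨⋃ n, t n, countable_iUnion ht, fun A hA => ?_⟩
  obtain ⟨n, v, -, rfl⟩ := hA.fin_param
  obtain ⟨i, hi, hv⟩ := mem_iUnion₂.1 (htU n (mem_univ v))
  exact ⟨i, mem_iUnion.2 ⟨n, hi⟩, range_subset_iff.2 fun j => hv j (mem_univ j)⟩

/-- In a Lindelöf P-space one can select from a sequence of clopen `ω`-covers a sequence that
eventually contains every point. -/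
theorem exists_selection_of_omegaCovers {Z ι : Type*} [TopologicalSpace Z] [LindelofSpace Z]
    (hZ : ∀ z : Z, CountableInterFilter (𝓝 z)) (U : ℕ → ι → Set Z)
    (hU : ∀ k i, IsClopen (U k i)) (hω : ∀ k, ∀ A : Set Z, A.Finite → ∃ i, A ⊆ U k i) :
    ∃ i : ℕ → ι, ∀ z, ∀ᶠ k in atTop, z ∈ U k (i k) := by
  rcases isEmpty_or_nonempty Z with hZe | hZn
  · choose i hi using fun k => hω k ∅ finite_empty
    exact ⟨i, fun z => (hZe.false z).elim⟩
  choose t ht htω using fun k =>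
    exists_countable_omegaSubcover hZ (U k) (fun i => (hU k i).isOpen) (hω k)
  -- The membership pattern of a point in countably many clopen sets is locally constant in a
  -- P-space, so countably many points realize all patterns.
  have hloc : ∀ x, ∀ᶠ z in 𝓝 x, (fun p : Σ k, t k => z ∈ U p.1 p.2) =
      fun p : Σ k, t k => x ∈ U p.1 p.2 := fun x => by
    have := hZ x
    have := fun k => (ht k).to_subtype
    have h : ∀ᶠ z in 𝓝 x, ∀ p : Σ k, t k, (z ∈ U p.1 p.2 ↔ x ∈ U p.1 p.2) := by
      refine eventually_countable_forall.2 fun p => ?_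
      by_cases hx : x ∈ U p.1 p.2
      · filter_upwards [(hU p.1 p.2).isOpen.mem_nhds hx] with z hz using iff_of_true hz hx
      · filter_upwards [(hU p.1 p.2).compl.isOpen.mem_nhds hx] with z hz using iff_of_false hz hx
    filter_upwards [h] with z hz
    exact funext fun p => propext (hz p)
  obtain ⟨s, hs, hsf⟩ := exists_countable_forall_eq_of_locallyConstant _ hloc
  have hsne : s.Nonempty := let ⟨x, hx, _⟩ := hsf hZn.some; ⟨x, hx⟩
  obtain ⟨e, rfl⟩ := hs.exists_eq_range hsne
  -- The `k`-th choice captures the representatives `e 0, …, e k`; a point with the pattern of `e m`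
  -- is thus captured from stage `m` on.
  choose i hit hi using fun k => htω k (e '' Iic k) ((finite_Iic k).image e)
  refine ⟨i, fun z => ?_⟩
  obtain ⟨_, ⟨m, rfl⟩, hm⟩ := hsf z
  filter_upwards [eventually_ge_atTop m] with k hk
  have := congrFun hm ⟨k, i k, hit k⟩
  exact this.symm ▸ hi k (mem_image_of_mem e hk)

/-! ### Countable tightness -/

/-- The points in closures of countable subsets of `A` form a sequentially closed set, since
countable unions of countable sets are countable. -/
theorem SequentialSpace.hasCountableTightness {Z : Type*} [TopologicalSpace Z]
    [SequentialSpace Z] : HasCountableTightness Z := by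
  intro A z hz
  let S : Set Z := {z | ∃ B ⊆ A, B.Countable ∧ z ∈ closure B}
  have hS : IsSeqClosed S := by
    intro u a hu ha
    choose B hBA hB huB using hu
    refine ⟨⋃ n, B n, iUnion_subset hBA, countable_iUnion hB, ?_⟩
    exact isClosed_closure.mem_of_tendsto ha
      (Eventually.of_forall fun n => closure_mono (subset_iUnion B n) (huB n))
  have hAS : A ⊆ S := fun a ha =>
    ⟨{a}, singleton_subset_iff.2 ha, countable_singleton a, subset_closure rfl⟩
  exact closure_minimal hAS hS.isClosed hz

/-! ### The Baire topology -/

section BaireTopology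

variable {X Y : Type*} [TopologicalSpace X] [TopologicalSpace Y]

theorem IsZeroSet.iInter {Z : ℕ → Set X} (hZ : ∀ n, IsZeroSet (Z n)) :
    IsZeroSet (⋂ n, Z n) := by
  choose f hf hZf using hZ
  let g : ℕ → X → ℝ := fun n x => (1 / 2 : ℝ) ^ n * min |f n x| 1
  have hg0 : ∀ n x, 0 ≤ g n x := fun n x => by positivity
  have hg1 : ∀ n x, g n x ≤ (1 / 2 : ℝ) ^ n := fun n x =>
    mul_le_of_le_one_right (by positivity) (min_le_right _ _)
  have hsum : ∀ x, Summable fun n => g n x := fun x =>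
    Summable.of_nonneg_of_le (fun n => hg0 n x) (fun n => hg1 n x) summable_geometric_two
  refine ⟨fun x => ∑' n, g n x, ?_, ?_⟩
  · refine continuous_tsum (fun n => ?_) summable_geometric_two fun n x => ?_
    · have := hf n
      fun_prop
    · rw [Real.norm_of_nonneg (hg0 n x)]
      exact hg1 n x
  · ext x
    have hzero : ∀ n, g n x = 0 ↔ x ∈ Z n := fun n => by
      have h2 : ((1 / 2 : ℝ) ^ n) ≠ 0 := by positivity
      rw [hZf n, mem_preimage, mem_singleton_iff, mul_eq_zero, or_iff_right h2,
        ← abs_eq_zero (a := f n x)]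
      constructor
      · intro h
        rcases min_choice |f n x| 1 with h' | h' <;> rw [h'] at h
        · exact h
        · exact absurd h one_ne_zero
      · intro h
        rw [h]
        exact min_eq_left zero_le_one
    have htsum : ∑' n, g n x = 0 ↔ ∀ n, g n x = 0 := by
      rw [← (hsum x).hasSum_iff, hasSum_zero_iff_of_nonneg fun n => hg0 n x, funext_iff]
      rfl
    rw [mem_iInter, mem_preimage, mem_singleton_iff, htsum]
    exact forall_congr' fun n => (hzero n).symm

theorem IsZeroSet.union {Z W : Set X} (hZ : IsZeroSet Z) (hW : IsZeroSet W) :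
    IsZeroSet (Z ∪ W) := by
  obtain ⟨f, hf, rfl⟩ := hZ
  obtain ⟨g, hg, rfl⟩ := hW
  exact ⟨fun x => f x * g x, hf.mul hg, by ext; simp⟩

theorem IsZeroSet.biUnion_finset {ι : Type*} (F : Finset ι) {Z : ι → Set X}
    (hZ : ∀ i, IsZeroSet (Z i)) : IsZeroSet (⋃ i ∈ F, Z i) := by
  classical
  induction F using Finset.induction_on with
  | empty => exact ⟨fun _ => 1, continuous_const, by ext; simp⟩
  | insert a F _ ih =>
    rw [Finset.set_biUnion_insert]
    exact (hZ a).union ih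

theorem Continuous.isZeroSet_fiber [TopologicalSpace.MetrizableSpace Y] {f : X → Y}
    (hf : Continuous f) (y : Y) : IsZeroSet (f ⁻¹' {y}) := by
  let := TopologicalSpace.metrizableSpaceMetric Y
  exact ⟨fun x => dist (f x) y, by fun_prop, by ext; simp⟩

theorem mem_nhds_baireModification_iff {x : BaireModification X} {s : Set (BaireModification X)} :
    s ∈ 𝓝 x ↔ ∃ Z : Set X, IsZeroSet Z ∧ x ∈ Z ∧ Z ⊆ s :=
  (isTopologicalBasis_baireModification X).mem_nhds_iff

theorem countableInterFilter_nhds_baireModification (x : BaireModification X) :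
    CountableInterFilter (𝓝 x) := by
  refine ⟨fun S hS hSx => ?_⟩
  rcases S.eq_empty_or_nonempty with rfl | hne
  · simp
  obtain ⟨s, rfl⟩ := hS.exists_eq_range hne
  choose Z hZ hxZ hZs using fun n => mem_nhds_baireModification_iff.1 (hSx (s n) ⟨n, rfl⟩)
  rw [sInter_range]
  exact mem_nhds_baireModification_iff.2
    ⟨⋂ n, Z n, IsZeroSet.iInter hZ, mem_iInter.2 hxZ, iInter_mono hZs⟩

/-- Baire functions are locally constant in the Baire topology. -/
theorem BaireClass.eventually_eq [TopologicalSpace.MetrizableSpace Y] {α : Ordinal.{0}}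
    {f : X → Y} (hf : BaireClass α f) (x : BaireModification X) :
    ∀ᶠ z : BaireModification X in 𝓝 x, f z = f x := by
  induction hf with
  | zero f hf =>
    exact mem_nhds_baireModification_iff.2 ⟨_, hf.isZeroSet_fiber (f x), rfl, subset_rfl⟩
  | limit α hα f u β hβ hu hf ih =>
    -- All `u n` are constant on one common neighbourhood of `x`, hence so is their limit.
    have := countableInterFilter_nhds_baireModification x
    filter_upwards [eventually_countable_forall.2 ih] with z hz
    refine tendsto_nhds_unique (hf z) ?_
    simp only [hz]
    exact hf x

theorem isClopen_preimage_of_eventually_eq {Z T : Type*} [TopologicalSpace Z] {f : Z → T}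
    (hf : ∀ x, ∀ᶠ z in 𝓝 x, f z = f x) (s : Set T) : IsClopen (f ⁻¹' s) :=
  have h := (IsLocallyConstant.iff_eventually_eq f).2 hf
  ⟨⟨h sᶜ⟩, h s⟩

theorem IsZeroSet.isClopen_baireModification {Z : Set X} (hZ : IsZeroSet Z) :
    IsClopen (X := BaireModification X) Z := by
  obtain ⟨f, hf, rfl⟩ := hZ
  exact isClopen_preimage_of_eventually_eq (Z := BaireModification X)
    (BaireClass.zero f hf).eventually_eq {0}

theorem exists_isZeroSet_of_finite_subset {U A : Set (BaireModification X)} (hU : IsOpen U)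
    (hA : A.Finite) (hAU : A ⊆ U) : ∃ Z : Set X, IsZeroSet Z ∧ A ⊆ Z ∧ Z ⊆ U := by
  have h : ∀ x, ∃ Z : Set X, IsZeroSet Z ∧ (x ∈ A → x ∈ Z) ∧ Z ⊆ U := fun x => by
    by_cases hx : x ∈ A
    · obtain ⟨Z, hZ, hxZ, hZU⟩ := mem_nhds_baireModification_iff.1 (hU.mem_nhds (hAU hx))
      exact ⟨Z, hZ, fun _ => hxZ, hZU⟩
    · exact ⟨∅, ⟨fun _ => 1, continuous_const, by simp⟩, fun h => absurd h hx, empty_subset _⟩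
  choose Z hZ hxZ hZU using h
  refine ⟨⋃ x ∈ hA.toFinset, Z x, IsZeroSet.biUnion_finset _ hZ, fun x hx => ?_, ?_⟩
  · exact mem_iUnion₂.2 ⟨x, hA.mem_toFinset.2 hx, hxZ x hx⟩
  · exact iUnion₂_subset fun x _ => hZU x

theorem hasPropertyGamma_of_lindelofSpace [LindelofSpace (BaireModification X)] :
    HasPropertyGamma (BaireModification X) := by
  rintro γ ⟨hγo, hγ⟩
  -- The selection needs clopen sets, so the cover is refined by zero-sets.
  let ι := {Z : Set X // IsZeroSet Z ∧ ∃ U ∈ γ, Z ⊆ U}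
  obtain ⟨i, hi⟩ := exists_selection_of_omegaCovers (Z := BaireModification X) (ι := ι)
    countableInterFilter_nhds_baireModification (fun _ Z => Z.1)
    (fun _ Z => Z.2.1.isClopen_baireModification) fun _ A hA => by
      obtain ⟨U, hU, hAU⟩ := hγ A hA
      obtain ⟨Z, hZ, hAZ, hZU⟩ := exists_isZeroSet_of_finite_subset (hγo U hU) hA hAU
      exact ⟨⟨Z, hZ, U, hU, hZU⟩, hAZ⟩
  choose U hU hZU using fun n => (i n).2.2
  refine ⟨U, hU, eq_univ_of_forall fun z => ?_⟩
  obtain ⟨n, hn⟩ := eventually_atTop.1 (hi z)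
  exact mem_iUnion.2 ⟨n, mem_iInter₂.2 fun k hk => hZU k (hn k hk)⟩

theorem HasPropertyGamma.lindelofSpace {Z : Type*} [TopologicalSpace Z]
    (h : HasPropertyGamma Z) : LindelofSpace Z := by
  refine lindelofSpace_of_nhds_subcover fun U hU => ?_
  obtain ⟨V, hV, hVU⟩ := h (range fun F : Finset Z => ⋃ x ∈ F, interior (U x))
    ⟨by rintro _ ⟨F, rfl⟩; exact isOpen_biUnion fun _ _ => isOpen_interior, fun A hA =>
      ⟨_, ⟨hA.toFinset, rfl⟩, fun x hx => mem_iUnion₂.2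
        ⟨x, hA.mem_toFinset.2 hx, mem_interior_iff_mem_nhds.2 (hU x)⟩⟩⟩
  choose F hF using hV
  refine ⟨⋃ n, (F n : Set Z), countable_iUnion fun n => (F n).countable_toSet, ?_⟩
  refine eq_univ_of_forall fun z => ?_
  obtain ⟨n, hn⟩ := mem_iUnion.1 (hVU ▸ mem_univ z : z ∈ ⋃ n, ⋂ i ≥ n, V i)
  have hzV := mem_iInter₂.1 hn n le_rfl
  rw [← hF n] at hzV
  obtain ⟨x, hx, hzx⟩ := mem_iUnion₂.1 hzV
  exact mem_iUnion₂.2 ⟨x, mem_iUnion.2 ⟨n, hx⟩, interior_subset hzx⟩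

/-! ### Function spaces -/

/-- That `f` lies in the closure of `A` means that, for each `k`, the sets where some `a ∈ A` is
`1/(k+1)`-close to `f` form an ω-cover; a selection from these clopen covers is a sequence
converging to `f`. -/
theorem frechetUrysohnSpace_of_lindelofSpace [TopologicalSpace.MetrizableSpace Y]
    [LindelofSpace (BaireModification X)] {H : Set (X → Y)} (hB : H ⊆ baireFunctions X Y) :
    FrechetUrysohnSpace H := by
  let := TopologicalSpace.metrizableSpaceMetric Y
  refine ⟨fun A f hf => ?_⟩
  have hloc : ∀ (a : H) (x : BaireModification X),
      ∀ᶠ z : BaireModification X in 𝓝 x, a.1 z = a.1 x := fun a x =>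
    let ⟨_, _, h⟩ := hB a.2
    h.eventually_eq x
  obtain ⟨i, hi⟩ := exists_selection_of_omegaCovers (Z := BaireModification X) (ι := A)
    countableInterFilter_nhds_baireModification
    (fun k a => {x : X | dist (a.1.1 x) (f.1 x) < 1 / ((k : ℝ) + 1)})
    (fun k a => isClopen_preimage_of_eventually_eq
      (f := fun x : BaireModification X => (a.1.1 x, f.1 x)) (fun x => by
        filter_upwards [hloc a.1 x, hloc f x] with z h1 h2
        rw [h1, h2]) {p : Y × Y | dist p.1 p.2 < 1 / ((k : ℝ) + 1)})
    fun k F hF => by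
      have hopen : IsOpen {h : H | ∀ x ∈ F, dist (h.1 x) (f.1 x) < 1 / ((k : ℝ) + 1)} := by
        simp only [ofPred_forall]
        refine hF.isOpen_biInter fun x _ => ?_
        refine isOpen_lt ?_ continuous_const
        exact (((continuous_apply (A := fun _ : X => Y) x).comp
          continuous_subtype_val).dist continuous_const)
      obtain ⟨a, ha, haA⟩ := mem_closure_iff.1 hf _ hopen fun x _ => by
        rw [dist_self]
        positivity
      exact ⟨⟨a, haA⟩, ha⟩
  refine ⟨fun k => (i k).1, fun k => (i k).2, ?_⟩
  rw [tendsto_subtype_rng, tendsto_pi_nhds]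
  intro x
  rw [tendsto_iff_dist_tendsto_zero]
  refine squeeze_zero' (Eventually.of_forall fun _ => dist_nonneg) ?_
    tendsto_one_div_add_atTop_nhds_zero_nat
  filter_upwards [hi x] with k hk using le_of_lt hk

/-- A finite subset of a zero-set is separated from its complement by a stable Baire function. -/
theorem IsYTychonoff.exists_stableBaireOne [TopologicalSpace.MetrizableSpace Y]
    (hX : IsYTychonoff X Y) {Z F : Set X} (hZ : IsZeroSet Z) (hF : F.Finite) (hFZ : F ⊆ Z)
    (y₀ y₁ : Y) :
    ∃ f ∈ stableBaireOne X Y, (∀ x ∈ F, f x = y₁) ∧ ∀ x ∉ Z, f x = y₀ := by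
  let := TopologicalSpace.metrizableSpaceMetric Y
  obtain ⟨h, hh, rfl⟩ := hZ
  have hsep : ∀ G : Set X, IsOpen G → F ⊆ G →
      ∃ g : X → Y, Continuous g ∧ (∀ x ∈ F, g x = y₁) ∧ ∀ x ∉ G, g x = y₀ := fun G hG hFG => by
    obtain ⟨g, hg, hgF, hgA⟩ := hX Gᶜ hG.isClosed_compl y₀ F hF (by simpa using hFG) fun _ => y₁
    exact ⟨g, hg, fun x hx => hgF ⟨x, hx⟩, fun x hx => hgA (mem_image_of_mem g hx)⟩
  let S := {M : X → ℝ // Continuous M ∧ ∀ x ∈ F, M x = 0}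
  have hS : ∀ (n : ℕ) (M : S), ∃ g : X → Y, Continuous g ∧ (∀ x ∈ F, g x = y₁) ∧
      ∀ x, 1 / ((n : ℝ) + 1) ≤ M.1 x → g x = y₀ := fun n M => by
    obtain ⟨g, hg, hgF, hgM⟩ := hsep {x | M.1 x < 1 / ((n : ℝ) + 1)}
      (isOpen_lt M.2.1 continuous_const) fun x hx => by
        rw [mem_ofPred_eq, M.2.2 x hx]
        positivity
    exact ⟨g, hg, hgF, fun x hx => hgM x (not_lt.2 hx)⟩
  choose g hg hgF hgM using hS
  -- `M n` starts at `|h|` and records the deviations from `y₁` so far. Where all `M n` vanish,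
  -- every `g n (M n)` equals `y₁`; elsewhere some `M m x` is positive, later ones are no smaller,
  -- and once `1/(n+1)` drops below it the value is `y₀`.
  let M : ℕ → S := fun n => Nat.rec (motive := fun _ => S)
    ⟨fun x => |h x|, hh.abs, fun x hx => abs_eq_zero.2 (hFZ hx)⟩
    (fun n M => ⟨fun x => max (M.1 x) (dist (g n M x) y₁),
      M.2.1.max ((hg n M).dist continuous_const), fun x hx => by
        simp [M.2.2 x hx, hgF n M x hx]⟩) n
  have hM : ∀ n x, (M (n + 1)).1 x = max ((M n).1 x) (dist (g n (M n) x) y₁) := fun _ _ => rfl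
  have hmono : ∀ x, Monotone fun n => (M n).1 x := fun x =>
    monotone_nat_of_le_succ fun n => (le_max_left _ _).trans_eq (hM n x).symm
  classical
  refine ⟨fun x => if ∀ n, (M n).1 x ≤ 0 then y₁ else y₀,
    ⟨fun n => g n (M n), fun n => hg n _, fun x => ?_⟩, fun x hx => ?_, fun x hx => ?_⟩
  · by_cases hx : ∀ n, (M n).1 x ≤ 0
    · convert finite_empty
      refine eq_empty_of_forall_notMem fun n hn => hn ?_
      refine Eq.trans ?_ (if_pos hx).symm
      exact dist_le_zero.1 ((le_max_right _ _).trans ((hM n x).symm.trans_le (hx (n + 1))))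
    · simp only [if_neg hx]
      push Not at hx
      obtain ⟨m, hm⟩ := hx
      obtain ⟨k, hk⟩ := exists_nat_one_div_lt hm
      refine (finite_Iio (max m k)).subset fun n hn => ?_
      by_contra hmn
      rw [mem_Iio, not_lt, max_le_iff] at hmn
      refine hn (hgM n (M n) x ?_)
      calc 1 / ((n : ℝ) + 1) ≤ 1 / ((k : ℝ) + 1) := Nat.one_div_le_one_div hmn.2
        _ ≤ (M m).1 x := hk.le
        _ ≤ (M n).1 x := hmono x hmn.1
  · exact if_pos fun n => ((M n).2.2 x hx).le
  · exact if_neg fun h0 => hx (abs_nonpos_iff.1 (h0 0))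

/-- The functions `f F`, equal to `y₁` on `F` and to `y₀` off the union of the `Z x`, `x ∈ F`,
converge to the constant `y₁`. If countably many of them accumulate there, each point has one with
value different from `y₀`, so the corresponding unions cover. -/
theorem lindelofSpace_of_hasCountableTightness [TopologicalSpace.MetrizableSpace Y]
    [Nontrivial Y] (hX : IsYTychonoff X Y) {H : Set (X → Y)} (hst : stableBaireOne X Y ⊆ H)
    (hH : HasCountableTightness H) : LindelofSpace (BaireModification X) := by
  obtain ⟨y₀, y₁, hy⟩ := exists_pair_ne Y
  refine lindelofSpace_of_nhds_subcover fun U hU => ?_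
  choose Z hZ hxZ hZU using fun x => mem_nhds_baireModification_iff.1 (hU x)
  choose f hfst hfF hfZ using fun F : Finset X => hX.exists_stableBaireOne
    (IsZeroSet.biUnion_finset F hZ) F.finite_toSet
    (fun x hx => mem_iUnion₂.2 ⟨x, hx, hxZ x⟩) y₀ y₁
  let φ : Finset X → H := fun F => ⟨f F, hst (hfst F)⟩
  let c : H := ⟨fun _ => y₁, hst ⟨fun _ _ => y₁, fun _ => continuous_const, by simp⟩⟩
  have hφ : Tendsto φ atTop (𝓝 c) := by
    rw [tendsto_subtype_rng, tendsto_pi_nhds]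
    refine fun x => tendsto_const_nhds.congr' ?_
    filter_upwards [eventually_ge_atTop {x}] with F hF
    exact (hfF F x (Finset.singleton_subset_iff.1 hF)).symm
  obtain ⟨B, hBφ, hB, hcB⟩ := hH (range φ) c
    (mem_closure_of_tendsto hφ (Eventually.of_forall mem_range_self))
  have hBφ' : ∀ b ∈ B, ∃ F, φ F = b := fun b hb => hBφ hb
  choose! T hT using hBφ'
  refine ⟨⋃ b ∈ B, (T b : Set X), hB.biUnion fun b _ => (T b).countable_toSet, ?_⟩
  refine eq_univ_of_forall fun x => ?_
  have hopen : IsOpen {h : H | h.1 x ≠ y₀} :=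
    isOpen_ne.preimage ((continuous_apply (A := fun _ : X => Y) x).comp continuous_subtype_val)
  obtain ⟨b, hne, hb⟩ := mem_closure_iff.1 hcB _ hopen hy.symm
  rw [← hT b hb] at hne
  have hx := not_not.1 (mt (hfZ (T b) x) hne)
  obtain ⟨a, ha, hxa⟩ := mem_iUnion₂.1 hx
  exact mem_iUnion₂.2 ⟨a, mem_iUnion₂.2 ⟨b, hb, ha⟩, hZU a hxa⟩

/-! ### Lindelöf scattered spaces -/

theorem IsYTychonoff.completelyRegularSpace [TopologicalSpace.MetrizableSpace Y] [Nontrivial Y]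
    (hX : IsYTychonoff X Y) : CompletelyRegularSpace X := by
  let := TopologicalSpace.metrizableSpaceMetric Y
  obtain ⟨y₀, y₁, hy⟩ := exists_pair_ne Y
  refine ⟨fun x A hA hx => ?_⟩
  obtain ⟨g, hg, hgx, hgA⟩ := hX A hA y₀ {x} (finite_singleton x)
    (singleton_subset_iff.2 hx) fun _ => y₁
  have hd : 0 < dist y₀ y₁ := dist_pos.2 hy
  refine ⟨fun z => projIcc 0 1 zero_le_one (dist (g z) y₁ / dist y₀ y₁), ?_, ?_, ?_⟩
  · exact continuous_projIcc.comp ((hg.dist continuous_const).div_const _)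
  · simp [hgx ⟨x, rfl⟩, projIcc_left]
  · intro z hz
    have : g z = y₀ := hgA (mem_image_of_mem g hz)
    simp [this, hd.ne', projIcc_right]

theorem exists_isZeroSet_of_mem_nhds [CompletelyRegularSpace X] {x : X} {U : Set X}
    (hU : U ∈ 𝓝 x) : ∃ Z : Set X, IsZeroSet Z ∧ x ∈ Z ∧ Z ⊆ U := by
  obtain ⟨V, hVU, hV, hxV⟩ := mem_nhds_iff.1 hU
  obtain ⟨f, hf, hfx, hfV⟩ := CompletelyRegularSpace.completely_regular x Vᶜ hV.isClosed_compl
    (not_not.2 hxV)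
  refine ⟨_, ⟨fun z => f z, continuous_subtype_val.comp hf, rfl⟩, by simp [hfx], fun z hz => ?_⟩
  by_contra hzU
  have h1 := hfV (fun h => hzU (hVU h) : z ∈ Vᶜ)
  simp [h1] at hz

theorem lindelofSpace_of_lindelofSpace_baireModification [CompletelyRegularSpace X]
    [LindelofSpace (BaireModification X)] : LindelofSpace X :=
  lindelofSpace_of_nhds_subcover fun U hU =>
    LindelofSpace.elim_nhds_subcover (X := BaireModification X) U fun x =>
      mem_nhds_baireModification_iff.2 (exists_isZeroSet_of_mem_nhds (hU x))

/-- `P` defines a σ-ideal, and `G` is the set of points where it holds locally; closed subsets of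
`G` belong to the ideal because `X` is Lindelöf. It remains to exclude an isolated point of `Gᶜ`. -/
theorem IsScatteredSpace.lindelofSpace_baireModification [RegularSpace X] [LindelofSpace X]
    (hX : IsScatteredSpace X) : LindelofSpace (BaireModification X) := by
  refine lindelofSpace_of_nhds_subcover fun U hU => ?_
  let P : Set X → Prop := fun V => ∃ t : Set X, t.Countable ∧ V ⊆ ⋃ x ∈ t, U x
  have hPmono : ∀ {V W}, V ⊆ W → P W → P V := fun hVW ⟨t, ht, hW⟩ => ⟨t, ht, hVW.trans hW⟩
  have hPunion : ∀ S : Set (Set X), S.Countable → (∀ V ∈ S, P V) → P (⋃₀ S) := fun S hS hV => by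
    choose! t ht htV using hV
    refine ⟨⋃ V ∈ S, t V, hS.biUnion ht, sUnion_subset fun V hVS => (htV V hVS).trans ?_⟩
    exact biUnion_subset_biUnion_left (subset_biUnion_of_mem hVS)
  let G : Set X := {x | ∃ V ∈ 𝓝 x, P V}
  have hPG : ∀ C : Set X, IsClosed C → C ⊆ G → P C := fun C hC hCG => by
    choose! V hV hPV using hCG
    obtain ⟨t, ht, htC, hCt⟩ := hC.isLindelof.elim_nhds_subcover V hV
    rw [← sUnion_image] at hCt
    exact hPmono hCt (hPunion _ (ht.image V) (forall_mem_image.2 fun x hx => hPV (htC x hx)))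
  suffices hG : G = univ by
    obtain ⟨t, ht, hX⟩ := hPG univ isClosed_univ hG.ge
    exact ⟨t, ht, univ_subset_iff.1 hX⟩
  by_contra hG
  obtain ⟨p, hpG, W, hW, hWp⟩ := hX Gᶜ (nonempty_compl.2 hG)
  have hpW : p ∈ W := (hWp.symm ▸ mem_singleton p : p ∈ W ∩ Gᶜ).1
  obtain ⟨C, hC, hCcl, hCW⟩ := exists_mem_nhds_isClosed_subset (hW.mem_nhds hpW)
  obtain ⟨_, ⟨h, hh, rfl⟩, hpZ, hZU⟩ := mem_nhds_baireModification_iff.1 (hU p)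
  refine hpG ⟨C, hC, ?_⟩
  -- `C` minus the zero-set of `h` is a countable union of closed sets that avoid `p`, hence lie in
  -- `G`; the zero-set itself is inside `U p`.
  have hPn : ∀ n : ℕ, P (C ∩ {x | 1 / ((n : ℝ) + 1) ≤ |h x|}) := fun n => by
    refine hPG _ (hCcl.inter (isClosed_le continuous_const hh.abs)) fun x ⟨hxC, hxn⟩ => ?_
    by_contra hxG
    have hxp : x = p := hWp.subset ⟨hCW hxC, hxG⟩
    rw [mem_ofPred_eq, hxp, show h p = 0 from hpZ, abs_zero] at hxn
    exact absurd hxn (not_le.2 Nat.one_div_pos_of_nat)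
  obtain ⟨t, ht, htC⟩ := hPunion _ (countable_range _) (forall_mem_range.2 hPn)
  refine ⟨insert p t, ht.insert p, fun x hx => ?_⟩
  by_cases hxh : h x = 0
  · exact mem_iUnion₂.2 ⟨p, mem_insert p t, hZU hxh⟩
  · obtain ⟨n, hn⟩ := exists_nat_one_div_lt (abs_pos.2 hxh)
    exact biUnion_subset_biUnion_left (subset_insert p t)
      (htC (mem_sUnion.2 ⟨_, mem_range_self n, hx, hn.le⟩))

end BaireTopology

theorem theoremt {X Y : Type*} [TopologicalSpace X] [TopologicalSpace Y]
    [TopologicalSpace.MetrizableSpace Y] [Nontrivial Y] (hX : IsYTychonoff X Y)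
    (H : Set (X → Y)) (hst : stableBaireOne X Y ⊆ H) (hB : H ⊆ baireFunctions X Y) :
    List.TFAE
      [FrechetUrysohnSpace H,
       SequentialSpace H,
       HasCountableTightness H,
       LindelofSpace (BaireModification X),
       HasPropertyGamma (BaireModification X)] ∧
    (IsScatteredSpace X →
      List.TFAE
        [FrechetUrysohnSpace H,
         SequentialSpace H,
         HasCountableTightness H,
         LindelofSpace (BaireModification X),
         HasPropertyGamma (BaireModification X),
         LindelofSpace X]) := by
  have h12 : FrechetUrysohnSpace H → SequentialSpace H := fun _ => inferInstance
  have h23 : SequentialSpace H → HasCountableTightness H := fun _ =>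
    SequentialSpace.hasCountableTightness
  have h34 : HasCountableTightness H → LindelofSpace (BaireModification X) :=
    lindelofSpace_of_hasCountableTightness hX hst
  have h45 : LindelofSpace (BaireModification X) → HasPropertyGamma (BaireModification X) :=
    fun _ => hasPropertyGamma_of_lindelofSpace
  have h51 : HasPropertyGamma (BaireModification X) → FrechetUrysohnSpace H := fun h =>
    have := h.lindelofSpace
    frechetUrysohnSpace_of_lindelofSpace hB
  refine ⟨?_, fun hsc => ?_⟩
  · tfae_have 1 → 2 := h12
    tfae_have 2 → 3 := h23
    tfae_have 3 → 4 := h34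
    tfae_have 4 → 5 := h45
    tfae_have 5 → 1 := h51
    tfae_finish
  · have := hX.completelyRegularSpace
    tfae_have 1 → 2 := h12
    tfae_have 2 → 3 := h23
    tfae_have 3 → 4 := h34
    tfae_have 4 → 5 := h45
    tfae_have 5 → 1 := h51
    tfae_have 4 → 6 := fun _ => lindelofSpace_of_lindelofSpace_baireModification
    tfae_have 6 → 4 := fun _ => hsc.lindelofSpace_baireModification
    tfae_finish
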